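/- For a partition $\lambda=(\lambda_1\ge\cdots\ge\lambda_r)$ of $n$, say that $\lambda$ has a fixed point if $\lambda_i=i$ for some $1\le i\le r$. Let $f(n)$ be the number of partitions of $n$ with a fixed point, $g(n)$ the number of partitions of $n$ without one, and $p(n)$ the number of all partitions of $n$, with $p(0)=1$ and $p(m)=0$ for $m<0$. Let $\omega(\lambda)$ be the number of parts of $\lambda$ equal to $1$ and $\mu(\lambda)$ the number of parts of $\lambda$ greater than $\omega(\lambda)$. The crank of $\lambda$ is $\lambda_1$ if $\omega(\lambda)=0$, and $\mu(\lambda)-\omega(\lambda)$ if $\omega(\lambda)>0$. Let $M(m,n)$ be the number of partitions of $n$ with crank $m$. Then for all $n\ge 2$, \[ g(n)-f(n)=M(0,n)=p(n)+2\sum_{j\ge 1}(-1)^j\,p\!\left(n-\frac{j(j+1)}{2}\right). \] Moreover, $g(n)>f(n)$ for all $n>2$. -/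

import Mathlib

namespace PartitionFixedPoint

/-- The parts of a partition listed in nonincreasing order. -/
def sortedParts {n : ℕ} (lam : n.Partition) : List ℕ :=
  lam.parts.sort (· ≥ ·)

/-- A partition has a fixed point if its `i`-th part in nonincreasing order, counted from `1`,
equals `i` for some index `i`. List positions are counted from `0`, hence the shift. -/
def HasFixedPoint {n : ℕ} (lam : n.Partition) : Prop :=
  ∃ i : Fin (sortedParts lam).length, (sortedParts lam).get i = (i : ℕ) + 1

instance {n : ℕ} : DecidablePred (HasFixedPoint (n := n)) :=
  fun lam => inferInstanceAs
    (Decidable (∃ i : Fin (sortedParts lam).length, (sortedParts lam).get i = (i : ℕ) + 1))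

/-- `f n`: the number of partitions of `n` with a fixed point. -/
def f (n : ℕ) : ℕ :=
  (Finset.univ.filter fun lam : n.Partition => HasFixedPoint lam).card

/-- `g n`: the number of partitions of `n` without a fixed point. -/
def g (n : ℕ) : ℕ :=
  (Finset.univ.filter fun lam : n.Partition => ¬ HasFixedPoint lam).card

/-- The number of parts equal to `1`. -/
def numOnes {n : ℕ} (lam : n.Partition) : ℕ :=
  lam.parts.count 1

/-- The number of parts (with multiplicity) greater than the number of ones. -/
def numLarge {n : ℕ} (lam : n.Partition) : ℕ :=
  (lam.parts.filter fun x => numOnes lam < x).card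

/-- The Andrews–Garvan crank: the largest part if there are no ones, and otherwise the number of
parts exceeding the number of ones, minus the number of ones. -/
def crank {n : ℕ} (lam : n.Partition) : ℤ :=
  if numOnes lam = 0 then (lam.parts.sup : ℤ) else (numLarge lam : ℤ) - numOnes lam

/-- `M m n`: the number of partitions of `n` with crank `m`. -/
def M (m : ℤ) (n : ℕ) : ℕ :=
  (Finset.univ.filter fun lam : n.Partition => crank lam = m).card

/-- The partition function on the integers; it vanishes at negative arguments. -/
def p (m : ℤ) : ℕ :=
  if m < 0 then 0 else Fintype.card (m.toNat).Partition

end PartitionFixedPoint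

namespace PartitionFixedPoint

/-! Along a nonincreasing list, part minus position (counted from 0) strictly decreases, so it takes
a value `m` at most once, and if it skips `m` the list is cut at a unique gap. A fixed point is
shift 1. Let S_m(n) count partitions of n having shift m. Deleting the part at shift m and raising
the earlier parts by one gives S_m(n+m) + S_{m+1}(n) = p(n) (`listCount_hasShift_add`). Iterating
from m = 1 yields f(n) as an alternating sum over triangular numbers, and g - f = p - 2f. For the
crank, let N(n) count partitions with neither shift 1 nor shift 2, and b(n) those with shift 1 only.
Those of n with shift 2 only number b(n-1) (`listCount_hasShift_succ_not`), so g(n) = b(n-1) + N(n),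
while the deletion map gives f(n) = b(n-1) + N(n-1). Appending a 1 (`listCount_one_mem`) shows that
N(n) - N(n-1) counts the members of N(n) without ones; these correspond to crank zero
(`M_zero_eq_listCount`). -/

/-! ### Partitions as sorted lists. -/

/-- The nonincreasing lists of positive integers with sum `n`. -/
def partLists (n : ℕ) : Set (List ℕ) :=
  {L | L.Pairwise (· ≥ ·) ∧ (∀ x ∈ L, 0 < x) ∧ L.sum = n}

lemma sortedParts_mem_partLists {n : ℕ} (lam : n.Partition) :
    sortedParts lam ∈ partLists n := by
  refine ⟨Multiset.pairwise_sort _ _, fun x hx => ?_, ?_⟩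
  · exact lam.parts_pos ((Multiset.mem_sort _).1 hx)
  · have h : (sortedParts lam : Multiset ℕ) = lam.parts := Multiset.sort_eq _ _
    rw [← Multiset.sum_coe, h, lam.parts_sum]

lemma sortedParts_injective {n : ℕ} :
    Function.Injective (sortedParts : n.Partition → List ℕ) := by
  intro a b h
  apply Nat.Partition.ext
  rw [← Multiset.sort_eq a.parts (· ≥ ·), ← Multiset.sort_eq b.parts (· ≥ ·)]
  exact congrArg _ h

lemma exists_sortedParts_eq {n : ℕ} {L : List ℕ} (hL : L ∈ partLists n) :
    ∃ lam : n.Partition, sortedParts lam = L := by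
  obtain ⟨h1, h2, h3⟩ := hL
  refine ⟨⟨L, fun {x} hx => h2 x hx, by simpa using h3⟩, ?_⟩
  refine List.Perm.eq_of_pairwise (le := (· ≥ ·)) (fun a b _ _ h h' => le_antisymm h' h)
    (Multiset.pairwise_sort _ _) h1 ?_
  rw [← Multiset.coe_eq_coe]
  exact Multiset.sort_eq _ _

lemma partLists_eq_range (n : ℕ) :
    partLists n = Set.range (sortedParts : n.Partition → List ℕ) := by
  ext L
  exact ⟨exists_sortedParts_eq, by rintro ⟨lam, rfl⟩; exact sortedParts_mem_partLists lam⟩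

lemma finite_partLists (n : ℕ) : (partLists n).Finite := by
  rw [partLists_eq_range]; exact Set.finite_range _

/-- The number of partitions of `n` whose sorted list of parts satisfies `P`. -/
noncomputable def listCount (n : ℕ) (P : List ℕ → Prop) : ℕ :=
  {L ∈ partLists n | P L}.ncard

lemma card_filter_eq_listCount {n : ℕ} (Q : n.Partition → Prop) [DecidablePred Q]
    (P : List ℕ → Prop) (h : ∀ lam, Q lam ↔ P (sortedParts lam)) :
    (Finset.univ.filter Q).card = listCount n P := by
  rw [listCount, ← Set.ncard_coe_finset, ← Set.ncard_image_of_injective _ sortedParts_injective]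
  congr 1
  ext L
  simp only [Finset.coe_filter, Finset.mem_univ, true_and, Set.mem_image, Set.mem_ofPred_eq, h]
  constructor
  · rintro ⟨lam, hl, rfl⟩
    exact ⟨sortedParts_mem_partLists lam, hl⟩
  · rintro ⟨hL, hP⟩
    obtain ⟨lam, rfl⟩ := exists_sortedParts_eq hL
    exact ⟨lam, hP, rfl⟩

lemma listCount_split (n : ℕ) (P Q : List ℕ → Prop) :
    listCount n P = listCount n (fun L => P L ∧ Q L) + listCount n (fun L => P L ∧ ¬ Q L) := by
  unfold listCount
  have hfin : ∀ R : List ℕ → Prop, {L ∈ partLists n | R L}.Finite := fun R =>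
    (finite_partLists n).subset (Set.sep_subset _ _)
  rw [← Set.ncard_union_eq _ (hfin _) (hfin _)]
  · congr 1
    ext L
    simp only [Set.mem_ofPred_eq, Set.mem_union]
    tauto
  · rw [Set.disjoint_left]
    rintro L ⟨_, _, h⟩ ⟨_, _, h'⟩
    exact h' h

/-- Two counts agree when both counted sets are injective images of the same set. -/
lemma listCount_eq_of_images {ι : Type*} {m n : ℕ} {P Q : List ℕ → Prop} (Z : Set ι)
    (φ ψ : ι → List ℕ) (hφ : Set.InjOn φ Z) (hψ : Set.InjOn ψ Z)
    (hφ' : ∀ z ∈ Z, φ z ∈ partLists m ∧ P (φ z)) (hψ' : ∀ z ∈ Z, ψ z ∈ partLists n ∧ Q (ψ z))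
    (hP : ∀ L ∈ partLists m, P L → ∃ z ∈ Z, φ z = L)
    (hQ : ∀ L ∈ partLists n, Q L → ∃ z ∈ Z, ψ z = L) :
    listCount m P = listCount n Q := by
  have h1 : {L ∈ partLists m | P L} = φ '' Z := by
    ext L
    exact ⟨fun h => hP L h.1 h.2, by rintro ⟨z, hz, rfl⟩; exact hφ' z hz⟩
  have h2 : {L ∈ partLists n | Q L} = ψ '' Z := by
    ext L
    exact ⟨fun h => hQ L h.1 h.2, by rintro ⟨z, hz, rfl⟩; exact hψ' z hz⟩
  rw [listCount, listCount, h1, h2, hφ.ncard_image, hψ.ncard_image]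

/-! ### Shifts and gaps. -/

/-- Some part exceeds its position, counted from `0`, by exactly `m`. -/
def HasShift (m : ℕ) (L : List ℕ) : Prop :=
  ∃ A B : List ℕ, L = A ++ (A.length + m) :: B

lemma hasFixedPoint_iff {n : ℕ} (lam : n.Partition) :
    HasFixedPoint lam ↔ HasShift 1 (sortedParts lam) := by
  constructor
  · rintro ⟨⟨i, hi⟩, h⟩
    refine ⟨(sortedParts lam).take i, (sortedParts lam).drop (i + 1), ?_⟩
    have h' : (sortedParts lam)[i] = i + 1 := h
    rw [List.length_take, min_eq_left hi.le]
    conv_lhs => rw [← List.take_append_drop i (sortedParts lam), List.drop_eq_getElem_cons hi, h']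
  · rintro ⟨A, B, h⟩
    refine ⟨⟨A.length, by simp [h]⟩, ?_⟩
    simp [h]

/-- Part minus position is strictly decreasing, so it either hits `m` or jumps over it, and the jump
separates `A` from `B`. -/
lemma hasShift_or_exists_gap (L : List ℕ) (hL : L.Pairwise (· ≥ ·)) (m : ℕ) :
    HasShift m L ∨
      ∃ A B : List ℕ, L = A ++ B ∧ (∀ a ∈ A, A.length + m ≤ a) ∧ ∀ b ∈ B, b < A.length + m := by
  induction L generalizing m with
  | nil => exact Or.inr ⟨[], [], by simp⟩
  | cons x L ih =>
    rw [List.pairwise_cons] at hL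
    rcases lt_trichotomy x m with h | h | h
    · refine Or.inr ⟨[], x :: L, rfl, by simp, ?_⟩
      intro b hb
      rcases List.mem_cons.1 hb with rfl | hb
      · simpa using h
      · have := hL.1 b hb
        simp only [List.length_nil]; omega
    · exact Or.inl ⟨[], L, by simp [h]⟩
    -- Dropping the head lowers every position by one, so the tail is tested for `m + 1`.
    · rcases ih hL.2 (m + 1) with ⟨A, B, rfl⟩ | ⟨A, B, rfl, hA, hB⟩
      · exact Or.inl ⟨x :: A, B, by simp [add_assoc, add_comm 1]⟩
      · refine Or.inr ⟨x :: A, B, rfl, ?_, ?_⟩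
        · have hx : A.length + (m + 1) ≤ x := by
            cases A with
            | nil => simpa using h
            | cons y A =>
              have h1 := hA y (by simp)
              have h2 := hL.1 y (by simp)
              omega
          intro a ha
          simp only [List.length_cons]
          rcases List.mem_cons.1 ha with rfl | ha
          · omega
          · have := hA a ha; omega
        · intro b hb
          have := hB b hb
          simp only [List.length_cons]; omega

lemma not_hasShift_of_gap {A B : List ℕ} {m : ℕ} (hA : ∀ a ∈ A, A.length + m ≤ a)
    (hB : ∀ b ∈ B, b < A.length + m) : ¬ HasShift m (A ++ B) := by
  rintro ⟨C, D, h⟩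
  rcases List.append_eq_append_iff.1 h with ⟨E, rfl, h2⟩ | ⟨E, h1, h2⟩
  · have := hB (( A ++ E).length + m) (by simp [h2])
    simp at this
  · cases E with
    | nil =>
      have := hB (C.length + m) (by simp at h2; simp [← h2])
      simp at h1; subst h1; omega
    | cons e E =>
      simp at h2
      have := hA (C.length + m) (by simp [h1, h2])
      simp [h1] at this

lemma not_hasShift_iff {L : List ℕ} (hL : L.Pairwise (· ≥ ·)) (m : ℕ) :
    ¬ HasShift m L ↔
      ∃ A B : List ℕ, L = A ++ B ∧ (∀ a ∈ A, A.length + m ≤ a) ∧ ∀ b ∈ B, b < A.length + m := by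
  constructor
  · exact (hasShift_or_exists_gap L hL m).resolve_left
  · rintro ⟨A, B, rfl, hA, hB⟩
    exact not_hasShift_of_gap hA hB

/-- A cut of a list at a given gap is determined by the list. -/
lemma gap_unique {A B C D : List ℕ} {m : ℕ} (h : A ++ B = C ++ D)
    (hA : ∀ a ∈ A, A.length + m ≤ a) (hB : ∀ b ∈ B, b < A.length + m)
    (hC : ∀ a ∈ C, C.length + m ≤ a) (hD : ∀ b ∈ D, b < C.length + m) : A = C ∧ B = D := by
  rcases List.append_eq_append_iff.1 h with ⟨E, rfl, rfl⟩ | ⟨E, rfl, rfl⟩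
  · cases E with
    | nil => simp
    | cons e E =>
      have h1 := hB e (by simp)
      have h2 := hC e (by simp)
      simp at h2; omega
  · cases E with
    | nil => simp
    | cons e E =>
      have h1 := hD e (by simp)
      have h2 := hA e (by simp)
      simp at h2; omega

/-- Two parts at the same shift would increase with position, contradicting the order. -/
lemma shift_unique {A B C D : List ℕ} {m : ℕ}
    (hL : (A ++ (A.length + m) :: B).Pairwise (· ≥ ·))
    (h : A ++ (A.length + m) :: B = C ++ (C.length + m) :: D) : A = C ∧ B = D := by
  rcases List.append_eq_append_iff.1 h with ⟨E, rfl, h2⟩ | ⟨E, rfl, h2⟩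
  · cases E with
    | nil => simpa using h2
    | cons e E =>
      rw [h, List.pairwise_append] at hL
      have := hL.2.2 e (by simp) _ List.mem_cons_self
      simp at h2 this
      omega
  · cases E with
    | nil => simpa using h2.symm
    | cons e E =>
      rw [List.pairwise_append] at hL
      have := hL.2.2 e (by simp) _ List.mem_cons_self
      simp at h2 this
      omega

lemma mem_partLists_append_iff {n : ℕ} {A B : List ℕ} :
    A ++ B ∈ partLists n ↔ (A.Pairwise (· ≥ ·) ∧ B.Pairwise (· ≥ ·) ∧
      ∀ a ∈ A, ∀ b ∈ B, b ≤ a) ∧ ((∀ a ∈ A, 0 < a) ∧ ∀ b ∈ B, 0 < b) ∧ A.sum + B.sum = n := by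
  simp only [partLists, Set.mem_ofPred_eq, List.pairwise_append, List.sum_append, List.mem_append,
    or_imp, forall_and, ge_iff_le]

lemma sum_map_succ (A : List ℕ) : (A.map Nat.succ).sum = A.sum + A.length := by
  induction A with
  | nil => rfl
  | cons a A ih => simp [ih]; omega

lemma exists_map_succ_of_pos {A : List ℕ} (h : ∀ a ∈ A, 0 < a) : ∃ C, A = List.map Nat.succ C :=
  ⟨A.map Nat.pred, by
    rw [List.map_map]
    conv_lhs => rw [← List.map_id A]
    exact List.map_congr_left fun a ha => (Nat.succ_pred_eq_of_pos (h a ha)).symm⟩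

lemma pairwise_ge_map_succ {A : List ℕ} :
    (A.map Nat.succ).Pairwise (· ≥ ·) ↔ A.Pairwise (· ≥ ·) := by
  simp [List.pairwise_map]

/-! ### Bijections that move or remove shifts. -/

/-- Removing a part exceeding its position by `m` and raising all earlier parts by one. -/
lemma listCount_hasShift_add {m : ℕ} (hm : 0 < m) (n : ℕ) :
    listCount (n + m) (HasShift m) = listCount n (fun L => ¬ HasShift (m + 1) L) := by
  refine listCount_eq_of_images
    {z : List ℕ × List ℕ | z.1 ++ (z.1.length + m) :: z.2 ∈ partLists (n + m)}
    (fun z => z.1 ++ (z.1.length + m) :: z.2) (fun z => z.1.map Nat.succ ++ z.2) ?_ ?_ ?_ ?_ ?_ ?_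
  · rintro ⟨A, B⟩ hz ⟨C, D⟩ - h
    exact Prod.ext_iff.2 (shift_unique hz.1 h)
  · rintro ⟨A, B⟩ hz ⟨C, D⟩ hz' h
    simp only [Set.mem_ofPred_eq, mem_partLists_append_iff, List.mem_cons, forall_eq_or_imp,
      List.pairwise_cons] at hz hz'
    -- After raising, the gap at `m + 1` lies exactly between the two blocks, so they can be read
    -- off.
    have := gap_unique (m := m + 1) h (by simpa using fun a ha => by have := (hz.1.2.2 a ha).1; omega)
      (fun b hb => by have := hz.1.2.1.1 b hb; simp; omega)
      (by simpa using fun a ha => by have := (hz'.1.2.2 a ha).1; omega)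
      (fun b hb => by have := hz'.1.2.1.1 b hb; simp; omega)
    exact Prod.ext_iff.2 ⟨List.map_injective_iff.2 Nat.succ_injective this.1, this.2⟩
  · rintro ⟨A, B⟩ hz
    exact ⟨hz, A, B, rfl⟩
  · rintro ⟨A, B⟩ hz
    simp only [Set.mem_ofPred_eq, mem_partLists_append_iff, List.mem_cons, forall_eq_or_imp,
      List.pairwise_cons, List.sum_cons] at hz
    obtain ⟨⟨h1, ⟨h2, h3⟩, h4⟩, ⟨h5, h6, h7⟩, h8⟩ := hz
    refine ⟨mem_partLists_append_iff.2 ⟨⟨pairwise_ge_map_succ.2 h1, h3, ?_⟩, ⟨by simp, h7⟩, ?_⟩, ?_⟩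
    · simpa using fun a ha b hb => ((h4 a ha).2 b hb).trans (Nat.le_succ a)
    · dsimp only; rw [sum_map_succ]; omega
    · refine not_hasShift_of_gap ?_ fun b hb => ?_
      · simpa using fun a ha => by have := (h4 a ha).1; omega
      · have := h2 b hb
        simp; omega
  · rintro L hL ⟨A, B, rfl⟩
    exact ⟨(A, B), hL, rfl⟩
  · intro L hL hs
    obtain ⟨A', B, rfl, hA, hB⟩ := (not_hasShift_iff hL.1 _).1 hs
    rw [mem_partLists_append_iff] at hL
    obtain ⟨⟨h1, h2, h3⟩, ⟨h4, h5⟩, h6⟩ := hL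
    obtain ⟨A, rfl⟩ := exists_map_succ_of_pos h4
    refine ⟨(A, B), ?_, rfl⟩
    simp only [List.mem_map, forall_exists_index, and_imp, forall_apply_eq_imp_iff₂,
      List.length_map] at hA hB
    simp only [Set.mem_ofPred_eq, mem_partLists_append_iff, List.mem_cons, forall_eq_or_imp,
      List.pairwise_cons, List.sum_cons]
    rw [sum_map_succ] at h6
    refine ⟨⟨pairwise_ge_map_succ.1 h1, ⟨fun b hb => ?_, h2⟩, fun a ha => ⟨?_, fun b hb => ?_⟩⟩,
      ⟨fun a ha => ?_, by omega, h5⟩, by omega⟩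
    · have := hB b hb; simp only [ge_iff_le]; omega
    · have := hA a ha; omega
    · have := hA a ha; have := hB b hb; omega
    · have := hA a ha; omega

lemma listCount_hasShift_eq_zero {m n : ℕ} (h : n < m) : listCount n (HasShift m) = 0 := by
  rw [listCount, Set.ncard_eq_zero ((finite_partLists n).subset (Set.sep_subset _ _))]
  ext L
  simp only [Set.mem_ofPred_eq, Set.mem_empty_iff_false, iff_false, not_and]
  rintro hL ⟨A, B, rfl⟩
  rw [mem_partLists_append_iff] at hL
  have := hL.2.2
  simp at this
  omega

/-- Lowering a part that exceeds its position by `m + 1` when no part exceeds it by `m`. -/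
lemma listCount_hasShift_succ_not {m : ℕ} (hm : 0 < m) (n : ℕ) :
    listCount (n + 1) (fun L => ¬ HasShift m L ∧ HasShift (m + 1) L) =
      listCount n (fun L => HasShift m L ∧ ¬ HasShift (m + 1) L) := by
  refine listCount_eq_of_images
    -- The bound on the first block leaves room to raise the middle part and rules out shift `m + 1`
    -- before it; the bound on the second rules out shift `m` after it.
    {z : List ℕ × List ℕ | (∀ a ∈ z.1, z.1.length + m + 1 ≤ a) ∧ (∀ b ∈ z.2, b ≤ z.1.length + m) ∧
      z.1 ++ (z.1.length + m) :: z.2 ∈ partLists n}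
    (fun z => z.1 ++ (z.1.length + (m + 1)) :: z.2)
    (fun z => z.1 ++ (z.1.length + m) :: z.2) ?_ ?_ ?_ ?_ ?_ ?_
  · rintro ⟨A, B⟩ ⟨h1, h2, h3⟩ ⟨C, D⟩ - h
    refine Prod.ext_iff.2 (shift_unique ?_ h)
    have := h3.1
    simp only [List.pairwise_append, List.pairwise_cons, List.mem_cons, forall_eq_or_imp] at this ⊢
    exact ⟨this.1, ⟨fun b hb => (h2 b hb).trans (by simp), this.2.1.2⟩, fun a ha =>
      ⟨h1 a ha, (this.2.2 a ha).2⟩⟩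
  · rintro ⟨A, B⟩ ⟨h1, h2, h3⟩ ⟨C, D⟩ - h
    exact Prod.ext_iff.2 (shift_unique h3.1 h)
  · rintro ⟨A, B⟩ ⟨h1, h2, h3⟩
    refine ⟨?_, ?_, A, B, rfl⟩
    · simp only [mem_partLists_append_iff, List.pairwise_cons, List.mem_cons,
        forall_eq_or_imp, List.sum_cons] at h3 ⊢
      obtain ⟨⟨h4, ⟨h5, h6⟩, h7⟩, ⟨h8, h9, h10⟩, h11⟩ := h3
      exact ⟨⟨h4, ⟨fun b hb => (h2 b hb).trans (by simp), h6⟩, fun a ha =>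
        ⟨h1 a ha, (h7 a ha).2⟩⟩, ⟨h8, by omega, h10⟩, by omega⟩
    · have : A ++ (A.length + (m + 1)) :: B = (A ++ [A.length + (m + 1)]) ++ B := by simp
      simp only [this]
      refine not_hasShift_of_gap ?_ ?_
      · intro a ha
        rcases List.mem_append.1 ha with ha | ha
        · have : A.length + m + 1 ≤ a := h1 a ha
          simp; omega
        · simp at ha ⊢; omega
      · intro b hb
        have := h2 b hb
        simp at this ⊢; omega
  · rintro ⟨A, B⟩ ⟨h1, h2, h3⟩
    refine ⟨h3, ⟨A, B, rfl⟩, not_hasShift_of_gap h1 ?_⟩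
    intro b hb
    rcases List.mem_cons.1 hb with rfl | hb
    · simp
    · have := h2 b hb
      simp at this ⊢; omega
  · rintro L hL ⟨hs, A, B, rfl⟩
    simp only [mem_partLists_append_iff, List.pairwise_cons, List.mem_cons,
      forall_eq_or_imp, List.sum_cons] at hL
    obtain ⟨⟨h4, ⟨h5, h6⟩, h7⟩, ⟨h8, h9, h10⟩, h11⟩ := hL
    have hB : ∀ b ∈ B, b ≤ A.length + m := by
      cases B with
      | nil => simp
      | cons x B =>
        have hx : x ≤ A.length + m := by
          by_contra hx
          have := h5 x (by simp)
          -- Here `x` is forced to be `A.length + 1 + m` at position `A.length + 1`, a forbidden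
          -- shift `m`.
          refine hs ⟨A ++ [A.length + (m + 1)], B, ?_⟩
          simp; omega
        intro b hb
        rcases List.mem_cons.1 hb with rfl | hb
        · exact hx
        · exact ((List.pairwise_cons.1 h6).1 b hb).trans hx
    refine ⟨(A, B), ⟨fun a ha => (h7 a ha).1, hB, ?_⟩, rfl⟩
    simp only [mem_partLists_append_iff, List.pairwise_cons, List.mem_cons,
      forall_eq_or_imp, List.sum_cons]
    exact ⟨⟨h4, ⟨hB, h6⟩, fun a ha => ⟨by have := (h7 a ha).1; omega, (h7 a ha).2⟩⟩,
      ⟨h8, by omega, h10⟩, by omega⟩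
  · rintro L hL ⟨⟨A, B, rfl⟩, hs⟩
    have hL' := hL
    simp only [mem_partLists_append_iff, List.pairwise_cons, List.mem_cons,
      forall_eq_or_imp, List.sum_cons] at hL'
    obtain ⟨⟨h4, ⟨h5, h6⟩, h7⟩, ⟨h8, h9, h10⟩, h11⟩ := hL'
    refine ⟨(A, B), ⟨fun a ha => ?_, h5, hL⟩, rfl⟩
    rcases List.eq_nil_or_concat' A with rfl | ⟨A, x, rfl⟩
    · simp at ha
    · have hx : (A ++ [x]).length + m + 1 ≤ x := by
        have h := (h7 x (by simp)).1
        by_contra hx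
        refine hs ⟨A, ((A ++ [x]).length + m) :: B, ?_⟩
        simp at h hx ⊢; omega
      rcases List.mem_append.1 ha with ha | ha
      · exact hx.trans ((List.pairwise_append.1 h4).2.2 a ha x (by simp))
      · simp only [List.mem_singleton] at ha
        rwa [ha]

/-- Cut at the gap for `m`. The last entry of `A` has shift at least `m + 1`; excluding equality
raises its bound by one, and the earlier entries dominate it. -/
lemma not_hasShift_and_succ_iff {L : List ℕ} (hL : L.Pairwise (· ≥ ·)) (m : ℕ) :
    ¬ HasShift m L ∧ ¬ HasShift (m + 1) L ↔
      ∃ A B : List ℕ, L = A ++ B ∧ (∀ a ∈ A, A.length + m + 1 ≤ a) ∧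
        ∀ b ∈ B, b < A.length + m := by
  constructor
  · rintro ⟨h1, h2⟩
    obtain ⟨A, B, rfl, hA, hB⟩ := (not_hasShift_iff hL _).1 h1
    refine ⟨A, B, rfl, fun a ha => ?_, hB⟩
    rcases List.eq_nil_or_concat' A with rfl | ⟨A, x, rfl⟩
    · simp at ha
    · have hx : (A ++ [x]).length + m + 1 ≤ x := by
        have h := hA x (by simp)
        by_contra hx
        refine h2 ⟨A, B, ?_⟩
        simp at h hx ⊢; omega
      rcases List.mem_append.1 ha with ha | ha
      · exact hx.trans ((List.pairwise_append.1 (List.pairwise_append.1 hL).1).2.2 a ha x (by simp))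
      · simp only [List.mem_singleton] at ha
        rwa [ha]
  · rintro ⟨A, B, rfl, hA, hB⟩
    exact ⟨not_hasShift_of_gap (fun a ha => (Nat.le_succ _).trans (hA a ha)) hB,
      not_hasShift_of_gap hA fun b hb => (hB b hb).trans (Nat.lt_succ_self _)⟩

/-- Appending a part equal to one. -/
lemma listCount_one_mem {n : ℕ} (hn : 0 < n) :
    listCount (n + 1) (fun L => (¬ HasShift 1 L ∧ ¬ HasShift 2 L) ∧ 1 ∈ L) =
      listCount n (fun L => ¬ HasShift 1 L ∧ ¬ HasShift 2 L) := by
  refine listCount_eq_of_images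
    {L : List ℕ | L ∈ partLists n ∧ ¬ HasShift 1 L ∧ ¬ HasShift 2 L}
    (fun L => L ++ [1]) id ?_ (Set.injOn_id _) ?_ (fun L hL => hL) ?_
    (fun L hL h => ⟨L, ⟨hL, h⟩, rfl⟩)
  · intro L _ L' _ h
    exact List.append_cancel_right h
  · rintro L ⟨hL, hs⟩
    have hL1 : L ++ [1] ∈ partLists (n + 1) := by
      rw [mem_partLists_append_iff]
      refine ⟨⟨hL.1, by simp, ?_⟩, ⟨hL.2.1, by simp⟩, by simp [hL.2.2]⟩
      simpa using fun a ha => Nat.succ_le_of_lt (hL.2.1 a ha)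
    refine ⟨hL1, ?_, by simp⟩
    obtain ⟨A, B, rfl, hA, hB⟩ := (not_hasShift_and_succ_iff hL.1 1).1 hs
    refine (not_hasShift_and_succ_iff hL1.1 1).2 ⟨A, B ++ [1], by simp, hA, ?_⟩
    -- With `A` empty all parts would be below 1, impossible for `n > 0`. Once `A` is nonempty, a
    -- new 1 fits below the gap.
    have hA0 : 0 < A.length := by
      rcases A.eq_nil_or_concat' with rfl | ⟨A, x, rfl⟩
      · cases B with
        | nil => have := hL.2.2; simp at this; omega
        | cons x B =>
          have := hB x (by simp)
          have := hL.2.1 x (by simp)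
          simp at *; omega
      · simp
    intro b hb
    rcases List.mem_append.1 hb with hb | hb
    · exact hB b hb
    · simp at hb; omega
  · rintro L hL ⟨hs, h1⟩
    obtain ⟨A, B, rfl, hA, hB⟩ := (not_hasShift_and_succ_iff hL.1 1).1 hs
    have h1B : 1 ∈ B := by
      rcases List.mem_append.1 h1 with h | h
      · have := hA 1 h; omega
      · exact h
    rcases List.eq_nil_or_concat' B with rfl | ⟨B, x, rfl⟩
    · simp at h1B
    · have hL' := mem_partLists_append_iff.1 hL
      have hx : x = 1 := by
        have hx0 := hL'.2.1.2 x (by simp)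
        rcases List.mem_append.1 h1B with h | h
        · have := (List.pairwise_append.1 hL'.1.2.1).2.2 1 h x (by simp)
          omega
        · exact (List.mem_singleton.1 h).symm
      subst hx
      rw [← List.append_assoc] at hL
      have hL'' := mem_partLists_append_iff.1 hL
      have hAB : A ++ B ∈ partLists n := by
        refine ⟨hL''.1.1, hL''.2.1.1, ?_⟩
        have := hL''.2.2
        simpa using this
      exact ⟨A ++ B, ⟨hAB, (not_hasShift_and_succ_iff hAB.1 1).2
        ⟨A, B, rfl, hA, fun b hb => hB b (by simp [hb])⟩⟩, by simp⟩

/-! ### Partitions of crank zero. -/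

lemma crank_eq_zero_iff {n : ℕ} (hn : 0 < n) (lam : n.Partition) :
    crank lam = 0 ↔ (sortedParts lam).count 1 ≠ 0 ∧
      ((sortedParts lam).filter fun x => (sortedParts lam).count 1 < x).length =
        (sortedParts lam).count 1 := by
  have h : (sortedParts lam : Multiset ℕ) = lam.parts := Multiset.sort_eq _ _
  have h1 : numOnes lam = (sortedParts lam).count 1 := by
    rw [numOnes, ← h, Multiset.coe_count]
  have h2 : numLarge lam =
      ((sortedParts lam).filter fun x => (sortedParts lam).count 1 < x).length := by
    rw [numLarge, h1, ← h, Multiset.filter_coe, Multiset.coe_card]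
  rw [crank, ← h2, ← h1]
  -- Without ones the crank is the largest part, which is positive since `n > 0`.
  split_ifs with h0
  · simp only [h0, ne_eq, not_true_eq_false, false_and, iff_false]
    intro hs
    have hs : lam.parts.sup = 0 := by exact_mod_cast hs
    rcases Multiset.empty_or_exists_mem lam.parts with he | ⟨x, hx⟩
    · have := lam.parts_sum
      simp [he] at this
      omega
    · have := Multiset.le_sup hx
      have := lam.parts_pos hx
      omega
  · simp only [ne_eq, h0, not_false_eq_true, true_and]
    omega

/-- A nonincreasing list of positive numbers, split at a positive threshold and at one. -/
lemma eq_filter_append_replicate {L : List ℕ} (hL : L.Pairwise (· ≥ ·)) (hpos : ∀ x ∈ L, 0 < x)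
    {w : ℕ} (hw : 0 < w) :
    L = L.filter (fun x => w < x) ++
      (L.filter (fun x => 1 < x ∧ x ≤ w) ++ List.replicate (L.count 1) 1) := by
  refine List.Perm.eq_of_pairwise (le := (· ≥ ·)) (fun a b _ _ h h' => le_antisymm h' h) hL ?_ ?_
  · simp only [List.pairwise_append]
    refine ⟨hL.filter _, ⟨hL.filter _, List.pairwise_replicate_of_refl, ?_⟩, ?_⟩
    · intro a ha b hb
      simp at ha hb; omega
    · intro a ha b hb
      simp at ha hb; omega
  · rw [List.perm_iff_count]
    intro x
    by_cases hx : x ∈ L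
    · have h0 := hpos x hx
      simp only [List.count_append, List.count_replicate]
      by_cases h1 : x = 1
      · subst h1
        rw [List.count_eq_zero_of_not_mem (l := L.filter _) (by simp; omega),
          List.count_eq_zero_of_not_mem (l := L.filter _) (by simp)]
        simp
      · by_cases h2 : w < x
        · rw [List.count_filter (by simpa using h2),
            List.count_eq_zero_of_not_mem (l := L.filter _) (by simp; omega)]
          simp [Ne.symm h1]
        · rw [List.count_eq_zero_of_not_mem (l := L.filter (fun x => decide (w < x)))
              (by simp [h2]), List.count_filter (l := L) (by simp; omega)]
          simp [Ne.symm h1]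
    · rw [List.count_eq_zero_of_not_mem hx, List.count_eq_zero_of_not_mem]
      intro h
      simp only [List.mem_append, List.mem_filter, hx, false_and, false_or,
        List.mem_replicate] at h
      obtain ⟨h, rfl⟩ := h
      exact h (List.count_eq_zero_of_not_mem hx)

/-- Raising the large parts of a partition of crank zero by one, using up its ones. -/
lemma M_zero_eq_listCount {n : ℕ} (hn : 0 < n) :
    M 0 n = listCount n (fun L => (¬ HasShift 1 L ∧ ¬ HasShift 2 L) ∧ ¬ 1 ∈ L) := by
  rw [M, card_filter_eq_listCount _ (fun L => L.count 1 ≠ 0 ∧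
    (L.filter fun x => L.count 1 < x).length = L.count 1) (crank_eq_zero_iff hn)]
  have hcount : ∀ A B : List ℕ, (∀ a ∈ A, A.length < a) → (∀ b ∈ B, 1 < b ∧ b ≤ A.length) →
      (A ++ (B ++ List.replicate A.length 1)).count 1 = A.length := by
    intro A B hA hB
    have h1 : A.count 1 = 0 := List.count_eq_zero_of_not_mem fun h => by
      have := hA 1 h
      have := List.length_pos_of_mem h
      omega
    have h2 : B.count 1 = 0 := List.count_eq_zero_of_not_mem fun h => by
      have := hB 1 h
      omega
    simp [h1, h2]
  refine listCount_eq_of_images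
    -- `z.1` holds the large parts and `z.2` the middle ones; crank zero makes the number of ones
    -- `z.1.length`, just enough to raise each large part by one.
    {z : List ℕ × List ℕ | 0 < z.1.length ∧ (z.1.Pairwise (· ≥ ·) ∧ z.2.Pairwise (· ≥ ·)) ∧
      (∀ a ∈ z.1, z.1.length < a) ∧ (∀ b ∈ z.2, 1 < b ∧ b ≤ z.1.length) ∧
      z.1.sum + z.2.sum + z.1.length = n}
    (fun z => z.1 ++ (z.2 ++ List.replicate z.1.length 1))
    (fun z => z.1.map Nat.succ ++ z.2) ?_ ?_ ?_ ?_ ?_ ?_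
  · rintro ⟨A, B⟩ ⟨h0, -, h1, h2, -⟩ ⟨C, D⟩ ⟨k0, -, k1, k2, -⟩ h
    dsimp only at *
    have hlen : A.length = C.length := by
      rw [← hcount A B h1 h2, ← hcount C D k1 k2, h]
    obtain ⟨rfl, h⟩ := List.append_inj h hlen
    rw [List.append_cancel_right h]
  · rintro ⟨A, B⟩ ⟨h0, -, h1, h2, -⟩ ⟨C, D⟩ ⟨k0, -, k1, k2, -⟩ h
    dsimp only at *
    have := gap_unique (m := 1) h (by simpa using fun a ha => (h1 a ha).le)
      (by simpa [Nat.lt_succ_iff] using fun b hb => (h2 b hb).2) (by simpa using fun a ha => (k1 a ha).le)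
      (by simpa [Nat.lt_succ_iff] using fun b hb => (k2 b hb).2)
    exact Prod.ext_iff.2 ⟨List.map_injective_iff.2 Nat.succ_injective this.1, this.2⟩
  · rintro ⟨A, B⟩ ⟨h0, ⟨h3, h4⟩, h1, h2, h5⟩
    dsimp only at *
    rw [hcount A B h1 h2]
    refine ⟨?_, h0.ne', ?_⟩
    · simp only [mem_partLists_append_iff, List.pairwise_append, List.sum_append,
        List.sum_replicate, List.mem_append, List.mem_replicate]
      refine ⟨⟨h3, ⟨h4, List.pairwise_replicate_of_refl, ?_⟩, ?_⟩, ⟨?_, ?_⟩, ?_⟩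
      · rintro a ha b ⟨_, rfl⟩
        exact (h2 a ha).1.le
      · rintro a ha b (hb | ⟨_, rfl⟩)
        · exact (h2 b hb).2.trans (h1 a ha).le
        · exact (Nat.succ_le_of_lt h0).trans (h1 a ha).le
      · exact fun a ha => h0.trans (h1 a ha)
      · rintro b (hb | ⟨_, rfl⟩)
        · exact zero_lt_one.trans (h2 b hb).1
        · exact zero_lt_one
      · simp only [smul_eq_mul, mul_one]; omega
    · rw [List.filter_append, List.filter_append, List.filter_eq_self.2 (by simpa using h1),
        List.filter_eq_nil_iff.2 (by simpa using fun b hb => (h2 b hb).2),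
        List.filter_eq_nil_iff.2 (by simp; omega)]
      simp
  · rintro ⟨A, B⟩ ⟨h0, ⟨h3, h4⟩, h1, h2, h5⟩
    dsimp only at *
    have hmem : A.map Nat.succ ++ B ∈ partLists n := by
      refine mem_partLists_append_iff.2 ⟨⟨pairwise_ge_map_succ.2 h3, h4, ?_⟩,
        ⟨by simp, fun b hb => zero_lt_one.trans (h2 b hb).1⟩, ?_⟩
      · simpa using fun a ha b hb => by have := h1 a ha; have := (h2 b hb).2; omega
      · rw [sum_map_succ]; omega
    refine ⟨hmem, (not_hasShift_and_succ_iff hmem.1 1).2 ⟨_, B, rfl, ?_, ?_⟩, ?_⟩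
    · simpa using h1
    · simpa [Nat.lt_succ_iff] using fun b hb => (h2 b hb).2
    · rw [List.mem_append, not_or]
      refine ⟨?_, fun h => by have := h2 1 h; omega⟩
      rw [List.mem_map]
      rintro ⟨a, ha, h⟩
      have := h1 a ha
      omega
  · rintro L hL ⟨hw, hl⟩
    refine ⟨(L.filter fun x => L.count 1 < x, L.filter fun x => 1 < x ∧ x ≤ L.count 1), ?_, ?_⟩
    · have h := eq_filter_append_replicate hL.1 hL.2.1 (Nat.pos_of_ne_zero hw)
      have hsum := congrArg List.sum h
      simp only [List.sum_append, List.sum_replicate, smul_eq_mul, mul_one, hL.2.2] at hsum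
      refine ⟨?_, ⟨hL.1.filter _, hL.1.filter _⟩, ?_, ?_, ?_⟩
      · dsimp only; omega
      · dsimp only
        rw [hl]
        intro a ha
        simpa using (List.mem_filter.1 ha).2
      · dsimp only
        rw [hl]
        intro a ha
        simpa using (List.mem_filter.1 ha).2
      · dsimp only
        omega
    · dsimp only
      rw [hl]
      exact (eq_filter_append_replicate hL.1 hL.2.1 (Nat.pos_of_ne_zero hw)).symm
  · rintro L hL ⟨hs, hone⟩
    obtain ⟨A', B, rfl, hA, hB⟩ := (not_hasShift_and_succ_iff hL.1 1).1 hs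
    rw [mem_partLists_append_iff] at hL
    obtain ⟨⟨h1, h2, h3⟩, ⟨h4, h5⟩, h6⟩ := hL
    obtain ⟨A, rfl⟩ := exists_map_succ_of_pos h4
    rw [sum_map_succ] at h6
    simp only [List.mem_map, forall_exists_index, and_imp, forall_apply_eq_imp_iff₂,
      List.length_map] at hA hB
    have hB1 : ∀ b ∈ B, 1 < b := fun b hb => by
      have := h5 b hb
      have : b ≠ 1 := fun h => hone (by simp [← h, hb])
      omega
    refine ⟨(A, B), ⟨?_, ⟨pairwise_ge_map_succ.1 h1, h2⟩, fun a ha => ?_, fun b hb => ⟨hB1 b hb, ?_⟩,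
      by dsimp only; omega⟩, rfl⟩
    · rcases Nat.eq_zero_or_pos A.length with h0 | h0
      · exfalso
        rw [List.length_eq_zero_iff] at h0
        subst h0
        cases B with
        | nil => simp at h6; omega
        | cons x B =>
          have := hB x (by simp)
          have := hB1 x (by simp)
          simp at *; omega
      · exact h0
    · have := hA a ha
      dsimp only; omega
    · have := hB b hb
      dsimp only; omega

/-! ### Comparing `f`, `g` and the crank count. -/

lemma f_eq_listCount (n : ℕ) : f n = listCount n (HasShift 1) :=
  card_filter_eq_listCount _ _ hasFixedPoint_iff

lemma f_add_g (n : ℕ) : f n + g n = Fintype.card n.Partition :=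
  Finset.card_filter_add_card_filter_not (s := Finset.univ) fun lam : n.Partition =>
    HasFixedPoint lam

lemma listCount_add_not (n : ℕ) (P : List ℕ → Prop) :
    listCount n P + listCount n (fun L => ¬ P L) = Fintype.card n.Partition := by
  have h := listCount_split n (fun _ => True) P
  simp only [true_and] at h
  rw [← h, ← card_filter_eq_listCount (n := n) (fun _ => True) (fun _ => True) (by simp)]
  simp

theorem f_add_M_zero {n : ℕ} (hn : 2 ≤ n) : f n + M 0 n = g n := by
  obtain ⟨n, rfl⟩ : ∃ k, n = k + 2 := ⟨n - 2, by omega⟩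
  rw [M_zero_eq_listCount (by omega)]
  have e1 := f_add_g (n + 2)
  rw [f_eq_listCount] at e1 ⊢
  have e2 := listCount_add_not (n + 2) (HasShift 1)
  have e3 := listCount_split (n + 2) (fun L => ¬ HasShift 1 L) (HasShift 2)
  have e4 := listCount_split (n + 2) (fun L => ¬ HasShift 1 L ∧ ¬ HasShift 2 L) (1 ∈ ·)
  have e5 : listCount (n + 2) (fun L => (¬ HasShift 1 L ∧ ¬ HasShift 2 L) ∧ 1 ∈ L) =
    listCount (n + 1) (fun L => ¬ HasShift 1 L ∧ ¬ HasShift 2 L) :=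
    listCount_one_mem (Nat.succ_pos n)
  have e6 := listCount_split (n + 1) (fun L => ¬ HasShift 1 L) (HasShift 2)
  have e7 : listCount (n + 2) (fun L => ¬ HasShift 1 L ∧ HasShift 2 L) =
    listCount (n + 1) (fun L => HasShift 1 L ∧ ¬ HasShift 2 L) :=
    listCount_hasShift_succ_not one_pos (n + 1)
  have e8 : listCount (n + 1) (fun L => ¬ HasShift 1 L ∧ HasShift 2 L) =
    listCount n (fun L => HasShift 1 L ∧ ¬ HasShift 2 L) :=
    listCount_hasShift_succ_not one_pos n
  have e9 : listCount (n + 2) (HasShift 1) = listCount (n + 1) (fun L => ¬ HasShift 2 L) :=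
    listCount_hasShift_add one_pos (n + 1)
  have e10 := listCount_split (n + 1) (fun L => ¬ HasShift 2 L) (HasShift 1)
  simp only [and_comm (a := ¬ HasShift 2 _)] at e10
  omega

/-! ### The alternating sum over triangular numbers. -/

lemma p_natCast (n : ℕ) : p (n : ℤ) = Fintype.card n.Partition := by
  simp [p]

lemma p_of_neg {m : ℤ} (h : m < 0) : p m = 0 := if_pos h

/-- `listCount · (HasShift m)` with an integer size; it vanishes at negative arguments. -/
noncomputable def shiftCount (m : ℕ) (n : ℤ) : ℕ :=
  if n < 0 then 0 else listCount n.toNat (HasShift m)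

lemma shiftCount_eq_zero {m : ℕ} {n : ℤ} (h : n < m) : shiftCount m n = 0 := by
  unfold shiftCount
  split_ifs with h0
  · rfl
  · exact listCount_hasShift_eq_zero (by omega)

/-- `listCount_hasShift_add` extended to all integers: every term vanishes when `n < m`, so the
recurrence iterates without size conditions. -/
lemma shiftCount_add {m : ℕ} (hm : 0 < m) (n : ℤ) :
    shiftCount m n + shiftCount (m + 1) (n - m) = p (n - m) := by
  by_cases h : n - m < 0
  · rw [p_of_neg h, shiftCount_eq_zero (by omega), shiftCount_eq_zero (by omega)]
  · obtain ⟨k, hk⟩ : ∃ k : ℕ, n - m = k := ⟨(n - m).toNat, by omega⟩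
    obtain rfl : n = ((k + m : ℕ) : ℤ) := by push_cast; omega
    rw [hk, p_natCast, ← listCount_add_not k (HasShift (m + 1))]
    simp only [shiftCount, Int.natCast_nonneg, not_lt.2, if_false, Int.toNat_natCast]
    rw [listCount_hasShift_add hm, add_comm]

lemma shiftCount_one_eq_sum (n : ℤ) (N : ℕ) :
    (shiftCount 1 n : ℤ) =
      ∑ j ∈ Finset.range N, (-1) ^ j * (p (n - ((j + 1 : ℕ) : ℤ) * ((j + 1 : ℕ) + 1) / 2) : ℤ) +
        (-1) ^ N * (shiftCount (N + 1) (n - (N : ℤ) * (N + 1) / 2) : ℤ) := by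
  induction N with
  | zero => simp
  | succ N ih =>
    have htri : ((N + 1 : ℕ) : ℤ) * ((N + 1 : ℕ) + 1) / 2 = (N : ℤ) * (N + 1) / 2 + (N + 1 : ℕ) := by
      rw [← Int.add_mul_ediv_right _ _ two_ne_zero]
      congr 1
      push_cast
      ring
    have h := shiftCount_add N.succ_pos (n - (N : ℤ) * (N + 1) / 2)
    rw [ih, Finset.sum_range_succ, htri, ← sub_sub, ← h]
    simp only [Nat.succ_eq_add_one]
    push_cast
    ring

lemma p_sub_triangle_eq_zero {n j : ℕ} (h : n < j) :
    p ((n : ℤ) - (j : ℤ) * ((j : ℤ) + 1) / 2) = 0 := by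
  refine p_of_neg ?_
  have : (j : ℤ) ≤ (j : ℤ) * ((j : ℤ) + 1) / 2 := by
    rw [Int.le_ediv_iff_mul_le two_pos]
    nlinarith
  omega

lemma f_eq_sum (n : ℕ) : (f n : ℤ) = ∑ j ∈ Finset.range n,
    (-1) ^ j * (p (n - ((j + 1 : ℕ) : ℤ) * ((j + 1 : ℕ) + 1) / 2) : ℤ) := by
  have h := shiftCount_one_eq_sum n n
  have h0 : (0 : ℤ) ≤ (n : ℤ) * (n + 1) / 2 := by positivity
  -- After `n` steps the remainder asks for shift `n + 1` in size at most `n`, so it vanishes.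
  rw [shiftCount_eq_zero (m := n + 1) (by push_cast; omega), Nat.cast_zero, mul_zero,
    add_zero] at h
  rw [← h, f_eq_listCount]
  simp [shiftCount]

lemma hasSum_f (n : ℕ) : HasSum (fun j : ℕ+ => (-1 : ℤ) ^ (j : ℕ) *
    (p ((n : ℤ) - (j : ℤ) * ((j : ℤ) + 1) / 2) : ℤ)) (-(f n : ℤ)) := by
  -- Reindexing by `j + 1` flips the sign, hence the limit `-f n`.
  rw [← Equiv.pnatEquivNat.symm.hasSum_iff, f_eq_sum, ← Finset.sum_neg_distrib]
  convert hasSum_sum_of_ne_finset_zero (s := Finset.range n) (L := .unconditional ℕ) ?_ using 1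
  · refine Finset.sum_congr rfl fun j _ => ?_
    simp [pow_succ]
  · intro j hj
    have := p_sub_triangle_eq_zero (n := n) (j := j + 1) (by simp at hj; omega)
    simp at this ⊢
    exact this

/-! ### Strict inequality. -/

lemma M_zero_pos {n : ℕ} (hn : 2 < n) : 0 < M 0 n := by
  -- For `n > 2` the partition `(n - 1, 1)` has a single one and a single part above 1.
  refine Finset.card_pos.2 ⟨⟨{n - 1, 1}, ?_, by simp; omega⟩, ?_⟩
  · intro i hi
    simp at hi
    omega
  · rw [Finset.mem_filter]
    refine ⟨Finset.mem_univ _, ?_⟩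
    have h1 : ({n - 1, 1} : Multiset ℕ).count 1 = 1 := by
      rw [Multiset.insert_eq_cons, Multiset.count_cons_of_ne (by omega),
        Multiset.count_singleton_self]
    have h2 : (({n - 1, 1} : Multiset ℕ).filter fun x => 1 < x).card = 1 := by
      rw [Multiset.insert_eq_cons, Multiset.filter_cons_of_pos _ (by omega)]
      simp [Multiset.filter_singleton]
    simp only [crank, numLarge, numOnes, h1, h2]
    simp

end PartitionFixedPoint

theorem mainTheorem2 :
    (∀ n : ℕ, 2 ≤ n →
      (PartitionFixedPoint.g n : ℤ) - (PartitionFixedPoint.f n : ℤ)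
          = (PartitionFixedPoint.M 0 n : ℤ) ∧
      Summable (fun j : ℕ+ => (-1 : ℤ) ^ (j : ℕ) *
          (PartitionFixedPoint.p ((n : ℤ) - (j : ℤ) * ((j : ℤ) + 1) / 2) : ℤ)) ∧
      (PartitionFixedPoint.M 0 n : ℤ)
          = (PartitionFixedPoint.p (n : ℤ) : ℤ) +
            2 * ∑' j : ℕ+, (-1 : ℤ) ^ (j : ℕ) *
              (PartitionFixedPoint.p ((n : ℤ) - (j : ℤ) * ((j : ℤ) + 1) / 2) : ℤ)) ∧
    (∀ n : ℕ, 2 < n → PartitionFixedPoint.f n < PartitionFixedPoint.g n) := by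
  refine ⟨fun n hn => ?_, fun n hn => ?_⟩
  · have h1 := PartitionFixedPoint.f_add_M_zero hn
    have h2 := PartitionFixedPoint.f_add_g n
    refine ⟨by omega, (PartitionFixedPoint.hasSum_f n).summable, ?_⟩
    rw [(PartitionFixedPoint.hasSum_f n).tsum_eq, PartitionFixedPoint.p_natCast]
    omega
  · have h1 := PartitionFixedPoint.f_add_M_zero hn.le
    have h2 := PartitionFixedPoint.M_zero_pos hn
    omega
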